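/- **Bi-Halfspace Theorem.** Let $n\ge 0$ be an integer and let $e_{n+1}$ be the last standard basis vector of $\mathbb{R}^{n+1}$. A vertical halfspace of $\mathbb{R}^{n+1}$ is a closed affine halfspace $$H=\{x\in\mathbb{R}^{n+1}:\ \langle x-b,w\rangle\ge 0\}$$ with $b,w\in\mathbb{R}^{n+1}$, $\|w\|=1$ and $\langle w,e_{n+1}\rangle=0$; two vertical halfspaces with unit normals $w_1,w_2$ are transverse if $w_1\neq w_2$ and $w_1\ne -w_2$. An immersed hypersurface is self-translating (in direction $e_{n+1}$, with unit speed) if at each of its points $$\boldsymbol{H}=\langle e_{n+1},\nu\rangle\,\nu ,$$ where $\nu$ is a unit normal at the point and $\boldsymbol{H}$ is the mean curvature vector, i.e. the trace, with respect to the induced metric, of the vector-valued second fundamental form $A(X,Y)=(\nabla^{\mathbb{R}^{n+1}}_XY)^{\perp}$. Let $M$ be a nonempty smooth $n$-dimensional manifold without boundary (not necessarily connected or orientable), and let $F:M\to\mathbb{R}^{n+1}$ be a smooth proper immersion which is self-translating. Then there do not exist two transverse vertical halfspaces $H_1,H_2$ of $\mathbb{R}^{n+1}$ with $F(M)\subseteq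 H_1\cap H_2$. -/

import Mathlib

open scoped Manifold ContDiff InnerProductSpace

noncomputable section

namespace BiHalfspace

/-- The translation direction `e_{n+1}`, the last standard basis vector of `ℝ^{n+1}`. -/
def eLast (n : ℕ) : EuclideanSpace ℝ (Fin (n + 1)) :=
  EuclideanSpace.single (Fin.last n) 1

/-- The closed affine halfspace `{x : ⟨x - b, w⟩ ≥ 0}` with boundary point `b` and inward
normal `w`. -/
def halfspace {n : ℕ} (b w : EuclideanSpace ℝ (Fin (n + 1))) :
    Set (EuclideanSpace ℝ (Fin (n + 1))) :=
  {x | 0 ≤ ⟪x - b, w⟫_ℝ}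

/-- A subset of `ℝ^{n+1}` is a vertical halfspace with inward unit normal `w` if `w` is a unit
vector orthogonal to `e_{n+1}` and the set is `{x : ⟨x - b, w⟩ ≥ 0}` for some `b`. -/
def IsVerticalHalfspace {n : ℕ} (H : Set (EuclideanSpace ℝ (Fin (n + 1))))
    (w : EuclideanSpace ℝ (Fin (n + 1))) : Prop :=
  ‖w‖ = 1 ∧ ⟪w, eLast n⟫_ℝ = 0 ∧ ∃ b, H = halfspace b w

/-- Two halfspaces are transverse if their unit normals are neither parallel nor antiparallel. -/
def AreTransverseVerticalHalfspaces {n : ℕ}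
    (H₁ H₂ : Set (EuclideanSpace ℝ (Fin (n + 1)))) : Prop :=
  ∃ w₁ w₂, IsVerticalHalfspace H₁ w₁ ∧ IsVerticalHalfspace H₂ w₂ ∧ w₁ ≠ w₂ ∧ w₁ ≠ -w₂

section Parametrized

variable {n : ℕ} {E : Type*} [NormedAddCommGroup E] [InnerProductSpace ℝ E]

/-- The tangent space at `p` of a parametrized submanifold `G`, as a subspace of the ambient
space. -/
def tangentPlane (G : EuclideanSpace ℝ (Fin n) → E) (p : EuclideanSpace ℝ (Fin n)) :
    Submodule ℝ E :=
  LinearMap.range (fderiv ℝ G p : EuclideanSpace ℝ (Fin n) →ₗ[ℝ] E)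

instance (G : EuclideanSpace ℝ (Fin n) → E) (p : EuclideanSpace ℝ (Fin n)) :
    FiniteDimensional ℝ (tangentPlane G p) := by
  unfold tangentPlane; infer_instance

/-- The matrix `g i j = ⟨∂ᵢ G, ∂ⱼ G⟩` of the induced metric (first fundamental form). -/
def inducedMetric (G : EuclideanSpace ℝ (Fin n) → E) (p : EuclideanSpace ℝ (Fin n)) :
    Matrix (Fin n) (Fin n) ℝ :=
  Matrix.of fun i j =>
    ⟪fderiv ℝ G p (EuclideanSpace.single i 1), fderiv ℝ G p (EuclideanSpace.single j 1)⟫_ℝ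

/-- The vector-valued second fundamental form: the component of the second derivative
`D²G(u, v)` normal to the tangent plane. -/
def secondFundamentalForm (G : EuclideanSpace ℝ (Fin n) → E) (p u v : EuclideanSpace ℝ (Fin n)) :
    E :=
  (tangentPlane G p)ᗮ.starProjection (fderiv ℝ (fderiv ℝ G) p u v)

/-- The mean curvature vector: the trace of the second fundamental form with respect to the
induced metric, `∑ g^{ij} A(∂ᵢ, ∂ⱼ)`. -/
def meanCurvatureVector (G : EuclideanSpace ℝ (Fin n) → E) (p : EuclideanSpace ℝ (Fin n)) : E :=
  ∑ i, ∑ j, (inducedMetric G p)⁻¹ i j •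
    secondFundamentalForm G p (EuclideanSpace.single i 1) (EuclideanSpace.single j 1)

end Parametrized

/-- An immersed hypersurface `F : M → ℝ^{n+1}` is self-translating (with velocity `e_{n+1}`) if
at each point its mean curvature vector equals `⟨e_{n+1}, ν⟩ ν` for the unit normals `ν` there
(both choices of `ν` give the same vector). The mean curvature vector and the tangent plane do
not depend on the coordinates, and are computed in the preferred chart at the point. -/
def IsSelfTranslating {n : ℕ} {M : Type*} [TopologicalSpace M]
    [ChartedSpace (EuclideanSpace ℝ (Fin n)) M] (F : M → EuclideanSpace ℝ (Fin (n + 1))) : Prop :=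
  ∀ x : M, ∀ ν ∈ (tangentPlane (F ∘ (chartAt (EuclideanSpace ℝ (Fin n)) x).symm)
      (chartAt (EuclideanSpace ℝ (Fin n)) x x))ᗮ, ‖ν‖ = 1 →
    meanCurvatureVector (F ∘ (chartAt (EuclideanSpace ℝ (Fin n)) x).symm)
      (chartAt (EuclideanSpace ℝ (Fin n)) x x) = ⟪eLast n, ν⟫_ℝ • ν

end BiHalfspace

end

/-!
On a hypersurface `Σ` translating with velocity `e`, the drift Laplacian `L = Δ + ⟨e, ∇ ·⟩` acts on
the restriction of an ambient function `u` by `L u = tr_{TΣ} D²u + Du(e)`, because the mean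
curvature vector is the normal part of `e`. At a local maximum of `u` on `Σ` this is nonpositive
(`trace_hessian_add_nonpos`).

Suppose `Σ` lies in the wedge `a₁ ≥ 0`, `a₂ ≥ 0`, where `aᵢ x = ⟨x - bᵢ, wᵢ⟩` and `wᵢ ⊥ e`. Let `f`
be the corner function `(a₁ - R)² + (a₂ - R)²`. Then
`L f = 2 (2 - ⟨w₁, ν⟩² - ⟨w₂, ν⟩²) ≥ 2 (1 - |⟨w₁, w₂⟩|)`, and this is a positive constant because the
wedge is transverse (`sq_inner_add_sq_inner_le`). On the square `[0, R]²` of values of `(a₁, a₂)` the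
function `f` is bounded by `2R²`, it is at most `R²` on the outer edges, and for large `R` it exceeds
`R²` at a given point of `Σ`.

The region over the square is not compact, so `f` is penalized by `ε √(1 + |x|²)`, whose drift
Laplacian is at most `ε (n + 1)` (`n` is the dimension). Properness of the immersion yields a maximum
of the penalized function over the square, and it is interior for small `ε`
(`exists_isLocalMax_corner`). There the maximum principle gives
`2 (1 - |⟨w₁, w₂⟩|) ≤ ε (n + 1)`, which is false for small `ε`. Replacing the square root by its
tangent at the maximum point makes the test function quadratic (`isLocalMax_cornerQuadratic`).
-/

open scoped Manifold ContDiff InnerProductSpace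
open Filter Topology

namespace BiHalfspace

/-! ### Calculus on a parametrized hypersurface -/

lemma _root_.IsLocalMax.deriv_deriv_nonpos {f : ℝ → ℝ} {x : ℝ} (h : IsLocalMax f x)
    (hc : ContinuousAt f x) : deriv (deriv f) x ≤ 0 := by
  by_contra! hpos
  have hmin := isLocalMin_of_deriv_deriv_pos hpos h.deriv_eq_zero hc
  have hconst : f =ᶠ[𝓝 x] fun _ => f x := by
    filter_upwards [h, hmin] with y h₁ h₂ using le_antisymm h₁ h₂
  have h2 : deriv f =ᶠ[𝓝 x] fun _ => 0 := by
    simpa using hconst.deriv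
  have := h2.deriv_eq
  simp only [deriv_const] at this
  exact hpos.ne' this

section Parametrized

variable {n : ℕ} {E : Type*} [NormedAddCommGroup E] [InnerProductSpace ℝ E]

/-- In vectors `v k` whose images form an orthonormal basis of the tangent plane, the trace with
respect to the induced metric is the plain sum, since `g⁻¹ = ∑ v k (v k)ᵀ`. -/
lemma meanCurvatureVector_eq_sum (G : EuclideanSpace ℝ (Fin n) → E) (p : EuclideanSpace ℝ (Fin n))
    (v : Fin n → EuclideanSpace ℝ (Fin n))
    (hv : Orthonormal ℝ fun k => fderiv ℝ G p (v k)) :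
    meanCurvatureVector G p = ∑ k, secondFundamentalForm G p (v k) (v k) := by
  have expand : ∀ x : EuclideanSpace ℝ (Fin n), x = ∑ i, x i • EuclideanSpace.single i (1 : ℝ) := by
    intro x
    simpa using ((EuclideanSpace.basisFun (Fin n) ℝ).sum_repr x).symm
  let V : Matrix (Fin n) (Fin n) ℝ := Matrix.of fun i k => v k i
  have hVgV : (V.transpose * inducedMetric G p) * V = 1 := by
    ext k l
    have := orthonormal_iff_ite.mp hv k l
    rw [Matrix.one_apply, ← this]
    conv_rhs => rw [expand (v k), expand (v l)]
    simp only [map_sum, map_smul, sum_inner, inner_sum, inner_smul_left, inner_smul_right,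
      Matrix.mul_apply, Matrix.transpose_apply, V, Matrix.of_apply, inducedMetric,
      Finset.sum_mul, Finset.mul_sum, RCLike.conj_to_real]
    refine Finset.sum_congr rfl fun i _ => Finset.sum_congr rfl fun j _ => ?_
    ring
  have hinv : (inducedMetric G p)⁻¹ = V * V.transpose := by
    apply Matrix.inv_eq_left_inv
    rw [Matrix.mul_assoc]
    exact mul_eq_one_comm.mp hVgV
  have hA : ∀ k, secondFundamentalForm G p (v k) (v k) = ∑ i, ∑ j, (v k i * v k j) •
      secondFundamentalForm G p (EuclideanSpace.single i 1) (EuclideanSpace.single j 1) := by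
    intro k
    unfold secondFundamentalForm
    conv_lhs => rw [expand (v k)]
    simp only [map_sum, map_smul, sum_apply,
      smul_apply, Finset.smul_sum, smul_smul]
    rw [Finset.sum_comm]
    refine Finset.sum_congr rfl fun i _ => Finset.sum_congr rfl fun j _ => ?_
    rw [mul_comm]
  simp only [meanCurvatureVector, hinv, hA, Matrix.mul_apply, Matrix.transpose_apply, V,
    Matrix.of_apply, Finset.sum_smul]
  symm
  rw [Finset.sum_comm]
  refine Finset.sum_congr rfl fun i _ => ?_
  rw [Finset.sum_comm]

/-- The second derivative test for `u ∘ G` along the line through `p` in direction `v`. -/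
lemma hessian_comp_nonpos {G : EuclideanSpace ℝ (Fin n) → E} {p : EuclideanSpace ℝ (Fin n)}
    (hG : ContDiffAt ℝ 2 G p) {u : E → ℝ} {u' : E → E →L[ℝ] ℝ} {u'' : E →L[ℝ] E →L[ℝ] ℝ}
    (hu : ∀ x, HasFDerivAt u (u' x) x) (hu' : HasFDerivAt u' u'' (G p))
    (hmax : IsLocalMax (u ∘ G) p) (v : EuclideanSpace ℝ (Fin n)) :
    u'' (fderiv ℝ G p v) (fderiv ℝ G p v) + u' (G p) (fderiv ℝ (fderiv ℝ G) p v v) ≤ 0 := by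
  let γ : ℝ → EuclideanSpace ℝ (Fin n) := fun s => p + s • v
  have hγ : ∀ s, HasDerivAt γ v s := fun s => by
    have := ((hasDerivAt_id s).smul_const v).const_add p
    rwa [one_smul] at this
  have hγ0 : γ 0 = p := by simp [γ]
  have hγt : Tendsto γ (𝓝 0) (𝓝 p) := by
    simpa only [hγ0] using (hγ 0).continuousAt.tendsto
  have hd : ∀ᶠ s in 𝓝 (0 : ℝ), DifferentiableAt ℝ G (γ s) := by
    have : ∀ᶠ q in 𝓝 p, DifferentiableAt ℝ G q :=
      (hG.eventually (by simp)).mono fun q hq => hq.differentiableAt (by simp)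
    exact hγt.eventually this
  have h1 : ∀ᶠ s in 𝓝 (0 : ℝ),
      HasDerivAt (u ∘ G ∘ γ) (u' (G (γ s)) (fderiv ℝ G (γ s) v)) s := by
    filter_upwards [hd] with s hs
    exact (hu _).comp_hasDerivAt s (hs.hasFDerivAt.comp_hasDerivAt s (hγ s))
  have hderiv : deriv (u ∘ G ∘ γ) =ᶠ[𝓝 0] fun s => u' (G (γ s)) (fderiv ℝ G (γ s) v) :=
    h1.mono fun s hs => hs.deriv
  have hG1 : HasFDerivAt G (fderiv ℝ G p) (γ 0) := by
    rw [hγ0]; exact (hG.differentiableAt (by simp)).hasFDerivAt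
  have hG2 : HasFDerivAt (fderiv ℝ G) (fderiv ℝ (fderiv ℝ G) p) (γ 0) := by
    rw [hγ0]
    exact ((hG.fderiv_right (m := 1) (by norm_num)).differentiableAt (by simp)).hasFDerivAt
  have hu0 : HasFDerivAt u' u'' ((G ∘ γ) 0) := by simpa [hγ0] using hu'
  have hA := hu0.comp_hasDerivAt 0 (hG1.comp_hasDerivAt 0 (hγ 0))
  have hB := (hG2.comp_hasDerivAt 0 (hγ 0)).clm_apply (hasDerivAt_const (0 : ℝ) v)
  have hC := hA.clm_apply hB
  have hsecond := (hderiv.deriv_eq.trans hC.deriv)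
  have hlm : IsLocalMax (u ∘ G ∘ γ) 0 := by
    have : IsLocalMax (u ∘ G) (γ 0) := by rwa [hγ0]
    exact this.comp_continuous (hγ 0).continuousAt
  have := hlm.deriv_deriv_nonpos h1.self_of_nhds.continuousAt
  rw [hsecond] at this
  simpa [hγ0] using this

/-- Under an injective differential, the normal line of a hypersurface is spanned by a unit
vector. -/
lemma exists_unit_normal {G : EuclideanSpace ℝ (Fin n) → EuclideanSpace ℝ (Fin (n + 1))}
    {p : EuclideanSpace ℝ (Fin n)} (hinj : Function.Injective (fderiv ℝ G p)) :
    Module.finrank ℝ (tangentPlane G p) = n ∧ ∃ ν ∈ (tangentPlane G p)ᗮ, ‖ν‖ = 1 ∧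
      ∀ y, y - ⟪y, ν⟫_ℝ • ν ∈ tangentPlane G p := by
  have hT : Module.finrank ℝ (tangentPlane G p) = n := by
    unfold tangentPlane
    rw [LinearMap.finrank_range_of_inj hinj]
    simp
  refine ⟨hT, ?_⟩
  have hN : Module.finrank ℝ (tangentPlane G p)ᗮ = 1 := by
    have := (tangentPlane G p).finrank_add_finrank_orthogonal
    rw [hT, finrank_euclideanSpace_fin] at this
    omega
  have b := stdOrthonormalBasis ℝ (tangentPlane G p)ᗮ
  rw [hN] at b
  have hb1 : ‖(b 0 : EuclideanSpace ℝ (Fin (n + 1)))‖ = 1 := b.norm_eq_one 0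
  have hb : ∀ z ∈ (tangentPlane G p)ᗮ, z = ⟪(b 0 : EuclideanSpace ℝ (Fin (n + 1))), z⟫_ℝ •
      (b 0 : EuclideanSpace ℝ (Fin (n + 1))) := fun z hz => by
    simpa using (congrArg Subtype.val (b.sum_repr' ⟨z, hz⟩)).symm
  refine ⟨b 0, (b 0).2, hb1, fun y => ?_⟩
  generalize (b 0 : EuclideanSpace ℝ (Fin (n + 1))) = ν at *
  rw [← Submodule.orthogonal_orthogonal (tangentPlane G p), Submodule.mem_orthogonal]
  intro z hz
  rw [hb z hz, inner_smul_left, inner_sub_right, inner_smul_right, real_inner_self_eq_norm_sq,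
    hb1, real_inner_comm y]
  simp

/-- The maximum principle for the drift Laplacian `Δ + ⟨e, ∇ ·⟩` of a translating hypersurface,
which on ambient functions `u` is `tr_T D²u + Du(e)`. -/
lemma trace_hessian_add_nonpos
    {G : EuclideanSpace ℝ (Fin n) → EuclideanSpace ℝ (Fin (n + 1))}
    {p : EuclideanSpace ℝ (Fin n)} (hG : ContDiffAt ℝ 2 G p)
    {e ν : EuclideanSpace ℝ (Fin (n + 1))}
    (hν : ∀ y, y - ⟪y, ν⟫_ℝ • ν ∈ tangentPlane G p)
    (hH : meanCurvatureVector G p = ⟪e, ν⟫_ℝ • ν)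
    (t : OrthonormalBasis (Fin n) ℝ (tangentPlane G p))
    {u : EuclideanSpace ℝ (Fin (n + 1)) → ℝ}
    {u' : EuclideanSpace ℝ (Fin (n + 1)) → EuclideanSpace ℝ (Fin (n + 1)) →L[ℝ] ℝ}
    {u'' : EuclideanSpace ℝ (Fin (n + 1)) →L[ℝ] EuclideanSpace ℝ (Fin (n + 1)) →L[ℝ] ℝ}
    (hu : ∀ x, HasFDerivAt u (u' x) x) (hu' : HasFDerivAt u' u'' (G p))
    (hmax : IsLocalMax (u ∘ G) p) :
    ∑ k, u'' (t k) (t k) + u' (G p) e ≤ 0 := by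
  choose v hv using fun k => (t k).2
  replace hv : ∀ k, fderiv ℝ G p (v k) = t k := hv
  have hon : Orthonormal ℝ fun k => fderiv ℝ G p (v k) := by
    simp only [hv]
    exact t.orthonormal.comp_linearIsometry (tangentPlane G p).subtypeₗᵢ
  have hcrit : ∀ z ∈ tangentPlane G p, u' (G p) z = 0 := by
    rintro _ ⟨w, rfl⟩
    have h0 := hmax.hasFDerivAt_eq_zero
      ((hu (G p)).comp p (hG.differentiableAt (by simp)).hasFDerivAt)
    exact congrArg (fun A : EuclideanSpace ℝ (Fin n) →L[ℝ] ℝ => A w) h0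
  have hproj : ∀ y, u' (G p) ((tangentPlane G p)ᗮ.starProjection y) = u' (G p) y := by
    intro y
    have := hcrit _ ((tangentPlane G p).starProjection_apply_mem y)
    rw [Submodule.starProjection_orthogonal_val, map_sub, this, sub_zero]
  have he : u' (G p) e = ∑ k, u' (G p) (fderiv ℝ (fderiv ℝ G) p (v k) (v k)) := by
    have h1 := hcrit _ (hν e)
    rw [map_sub, sub_eq_zero, ← hH, meanCurvatureVector_eq_sum G p v hon, map_sum] at h1
    rw [h1]
    exact Finset.sum_congr rfl fun k _ => hproj _
  rw [he, ← Finset.sum_add_distrib]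
  refine Finset.sum_nonpos fun k _ => ?_
  rw [← hv k]
  exact hessian_comp_nonpos hG hu hu' hmax (v k)

/-- Parseval's identity in the tangent plane, for the tangential part of an ambient vector. -/
lemma sum_sq_inner_tangent {V : Type*} [NormedAddCommGroup V] [InnerProductSpace ℝ V]
    {T : Submodule ℝ V} {ν : V} (hνT : ν ∈ Tᗮ) (hν1 : ‖ν‖ = 1)
    (hν : ∀ y, y - ⟪y, ν⟫_ℝ • ν ∈ T) (t : OrthonormalBasis (Fin n) ℝ T) (w : V) :
    ∑ k, ⟪w, t k⟫_ℝ ^ 2 = ‖w‖ ^ 2 - ⟪w, ν⟫_ℝ ^ 2 := by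
  have h := t.sum_sq_norm_inner_right ⟨_, hν w⟩
  have h1 : ∀ k, ‖⟪t k, (⟨_, hν w⟩ : T)⟫_ℝ‖ ^ 2 = ⟪w, t k⟫_ℝ ^ 2 := by
    intro k
    have h0 : ⟪(t k : V), ν⟫_ℝ = 0 := hνT _ (t k).2
    rw [Submodule.coe_inner, inner_sub_right, inner_smul_right, h0, real_inner_comm w]
    simp
  simp only [h1] at h
  rw [h, Submodule.coe_norm, norm_sub_sq_real, inner_smul_right, norm_smul, hν1]
  simp
  ring

/-- For unit vectors `w₁`, `w₂` the operator `∑ wᵢ ⊗ wᵢ` has no eigenvalue above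
`1 + |⟨w₁, w₂⟩|`, which is less than `2` unless `w₁ = ± w₂`. -/
lemma sq_inner_add_sq_inner_le {V : Type*} [NormedAddCommGroup V] [InnerProductSpace ℝ V]
    {w₁ w₂ ν : V} (h₁ : ‖w₁‖ = 1) (h₂ : ‖w₂‖ = 1) (hν : ‖ν‖ = 1) :
    ⟪w₁, ν⟫_ℝ ^ 2 + ⟪w₂, ν⟫_ℝ ^ 2 ≤ 1 + |⟪w₁, w₂⟫_ℝ| := by
  set a := ⟪w₁, ν⟫_ℝ with ha
  set b := ⟪w₂, ν⟫_ℝ with hb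
  have hcs := real_inner_le_norm (a • w₁ + b • w₂) ν
  rw [inner_add_left, inner_smul_left, inner_smul_left, ← ha, ← hb, hν, mul_one] at hcs
  have hsq : ‖a • w₁ + b • w₂‖ ^ 2 = a ^ 2 + b ^ 2 + 2 * (a * b) * ⟪w₁, w₂⟫_ℝ := by
    rw [norm_add_sq_real, norm_smul, norm_smul, h₁, h₂, inner_smul_left, inner_smul_right]
    simp
    ring
  have hle : (a * b) * ⟪w₁, w₂⟫_ℝ * 2 ≤ (a ^ 2 + b ^ 2) * |⟪w₁, w₂⟫_ℝ| := by
    have h3 : 2 * |a * b| ≤ a ^ 2 + b ^ 2 := by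
      rw [abs_mul, ← sq_abs a, ← sq_abs b]; nlinarith [sq_nonneg (|a| - |b|)]
    calc (a * b) * ⟪w₁, w₂⟫_ℝ * 2 ≤ |(a * b) * ⟪w₁, w₂⟫_ℝ| * 2 := by gcongr; exact le_abs_self _
      _ = (2 * |a * b|) * |⟪w₁, w₂⟫_ℝ| := by rw [abs_mul]; ring
      _ ≤ _ := by gcongr
  simp only [RCLike.conj_to_real] at hcs
  have h4 : (a ^ 2 + b ^ 2) ^ 2 ≤ (a ^ 2 + b ^ 2) * (1 + |⟪w₁, w₂⟫_ℝ|) := by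
    have : (a ^ 2 + b ^ 2) ^ 2 ≤ ‖a • w₁ + b • w₂‖ ^ 2 := by
      apply pow_le_pow_left₀ (by positivity)
      linarith
    nlinarith
  by_contra! hlt
  have hpos : 0 < a ^ 2 + b ^ 2 := lt_of_le_of_lt (by positivity) hlt
  nlinarith

end Parametrized

/-! ### Immersions in charts -/

section Chart

variable {n : ℕ} {M : Type*} [TopologicalSpace M] [ChartedSpace (EuclideanSpace ℝ (Fin n)) M]
  [IsManifold (𝓡 n) ∞ M] {F : M → EuclideanSpace ℝ (Fin (n + 1))}

lemma contDiffAt_comp_chartAt_symm (hF : ContMDiff (𝓡 n) (𝓡 (n + 1)) ∞ F) (x : M) :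
    ContDiffAt ℝ ∞ (F ∘ (chartAt (EuclideanSpace ℝ (Fin n)) x).symm)
      (chartAt (EuclideanSpace ℝ (Fin n)) x x) := by
  have h := contMDiffAt_symm_of_mem_maximalAtlas (I := 𝓡 n) (n := ∞)
    (IsManifold.chart_mem_maximalAtlas x) (mem_chart_target (EuclideanSpace ℝ (Fin n)) x)
  exact (hF.contMDiffAt.comp _ h).contDiffAt

/-- An immersion has injective differential in charts: its local normal form `a ↦ (a, 0)` has a
left inverse, hence so does `F ∘ φ⁻¹` near `φ x`, with a differentiable one. -/
lemma injective_fderiv_comp_chartAt_symm (hF : Manifold.IsImmersion (𝓡 n) (𝓡 (n + 1)) ∞ F) (x : M) :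
    Function.Injective (fderiv ℝ (F ∘ (chartAt (EuclideanSpace ℝ (Fin n)) x).symm)
      (chartAt (EuclideanSpace ℝ (Fin n)) x x)) := by
  set φ := chartAt (EuclideanSpace ℝ (Fin n)) x with hφ
  have h := hF.isImmersionAt x
  have hxφ : x ∈ φ.source := mem_chart_source _ x
  let π : EuclideanSpace ℝ (Fin (n + 1)) →L[ℝ] EuclideanSpace ℝ (Fin n) :=
    (ContinuousLinearMap.fst ℝ _ h.complement).comp
      (h.equiv.symm : _ →L[ℝ] EuclideanSpace ℝ (Fin n) × h.complement)
  let Ψ : EuclideanSpace ℝ (Fin (n + 1)) → EuclideanSpace ℝ (Fin n) :=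
    φ ∘ h.domChart.symm ∘ π ∘ h.codChart
  -- `π` inverts the normal form of the immersion
  have hnormal : ∀ y ∈ h.domChart.source, π (h.codChart (F y)) = h.domChart y := by
    intro y hy
    have hy' : h.domChart y ∈ (h.domChart.extend (𝓡 n)).target := by
      simpa using h.domChart.map_source hy
    have := h.writtenInCharts hy'
    simp only [Function.comp_apply, OpenPartialHomeomorph.extend_coe,
      OpenPartialHomeomorph.extend_coe_symm, modelWithCornersSelf_coe,
      modelWithCornersSelf_coe_symm, id, h.domChart.left_inv hy] at this
    simp [π, this]
  have hx := h.mem_domChart_source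
  have hΨ : DifferentiableAt ℝ Ψ (F x) := by
    have h1 : ContMDiffAt (𝓡 (n + 1)) (𝓡 (n + 1)) ∞ h.codChart (F x) :=
      contMDiffAt_of_mem_maximalAtlas h.codChart_mem_maximalAtlas h.mem_codChart_source
    have h2 : ContMDiffAt (𝓡 (n + 1)) (𝓡 n) ∞ π (h.codChart (F x)) := π.contMDiff.contMDiffAt
    have h3 : ContMDiffAt (𝓡 n) (𝓡 n) ∞ h.domChart.symm (π (h.codChart (F x))) := by
      rw [hnormal x hx]
      exact contMDiffAt_symm_of_mem_maximalAtlas h.domChart_mem_maximalAtlas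
        (h.domChart.map_source hx)
    have h4 : ContMDiffAt (𝓡 n) (𝓡 n) ∞ φ (h.domChart.symm (π (h.codChart (F x)))) := by
      rw [hnormal x hx, h.domChart.left_inv hx]
      exact contMDiffAt_of_mem_maximalAtlas (IsManifold.chart_mem_maximalAtlas x) hxφ
    have h5 : ContMDiffAt (𝓡 (n + 1)) (𝓡 n) ∞ Ψ (F x) := 
      ContMDiffAt.comp (F x) (g := φ) (f := h.domChart.symm ∘ π ∘ h.codChart) h4 <|
        ContMDiffAt.comp (F x) (g := h.domChart.symm) (f := π ∘ h.codChart) h3 (h2.comp _ h1)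
    exact h5.contDiffAt.differentiableAt (by simp)
  have hleft : Ψ ∘ (F ∘ φ.symm) =ᶠ[𝓝 (φ x)] id := by
    have hs : ∀ᶠ a in 𝓝 (φ x), φ.symm a ∈ h.domChart.source := by
      apply (φ.continuousAt_symm (φ.map_source hxφ)).eventually_mem
      rw [φ.left_inv hxφ]
      exact h.domChart.open_source.mem_nhds hx
    filter_upwards [hs, φ.open_target.mem_nhds (φ.map_source hxφ)] with a ha hat
    simp [Ψ, hnormal _ ha, h.domChart.left_inv ha, φ.right_inv hat]
  have hG : DifferentiableAt ℝ (F ∘ φ.symm) (φ x) :=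
    (contDiffAt_comp_chartAt_symm hF.contMDiff x).differentiableAt (by simp)
  have hΨ' : HasFDerivAt Ψ (fderiv ℝ Ψ (F x)) ((F ∘ φ.symm) (φ x)) := by
    simpa [φ.left_inv hxφ] using hΨ.hasFDerivAt
  have hid := (hΨ'.comp _ hG.hasFDerivAt).unique ((hasFDerivAt_id _).congr_of_eventuallyEq hleft)
  exact Function.LeftInverse.injective (g := fderiv ℝ Ψ (F x))
    fun a => congrArg (fun A : EuclideanSpace ℝ (Fin n) →L[ℝ] _ => A a) hid

end Chart

/-! ### The corner function on a wedge -/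

/-- On the square `[0, R]²` the function `(a₁ - R)² + (a₂ - R)²` exceeds `R²` only off the outer
edges. Penalized by a proper function it therefore attains a local maximum, as soon as it exceeds
`R²` somewhere. -/
lemma exists_isLocalMax_corner {M V : Type*} [TopologicalSpace M] [NormedAddCommGroup V]
    [ProperSpace V] {F : M → V} (hF : IsProperMap F) {a₁ a₂ : M → ℝ} (ha₁ : Continuous a₁)
    (ha₂ : Continuous a₂) (h₁ : ∀ q, 0 ≤ a₁ q) (h₂ : ∀ q, 0 ≤ a₂ q) {R ε : ℝ}
    (hε : 0 < ε) {q₀ : M} (hq₁ : a₁ q₀ ≤ R) (hq₂ : a₂ q₀ ≤ R)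
    (hq : R ^ 2 < (a₁ q₀ - R) ^ 2 + (a₂ q₀ - R) ^ 2 - ε * √(1 + ‖F q₀‖ ^ 2)) :
    ∃ q, IsLocalMax
      (fun q => (a₁ q - R) ^ 2 + (a₂ q - R) ^ 2 - ε * √(1 + ‖F q‖ ^ 2)) q := by
  set g : M → ℝ := fun q => (a₁ q - R) ^ 2 + (a₂ q - R) ^ 2 - ε * √(1 + ‖F q‖ ^ 2) with hg
  have hFc := hF.continuous
  have hgc : Continuous g := by fun_prop
  let K : Set M := {q | a₁ q ≤ R ∧ a₂ q ≤ R} ∩ F ⁻¹' Metric.closedBall 0 (2 * R ^ 2 / ε)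
  have hK : IsCompact K :=
    (hF.isCompact_preimage (isCompact_closedBall _ _)).inter_left
      ((isClosed_le ha₁ continuous_const).inter (isClosed_le ha₂ continuous_const))
  -- outside the ball the penalty exceeds the upper bound `2 R²` of the corner function
  have hout : ∀ q, a₁ q ≤ R → a₂ q ≤ R → R ^ 2 < g q → q ∈ K := by
    intro q h1 h2 h3
    refine ⟨⟨h1, h2⟩, ?_⟩
    rw [Set.mem_preimage, mem_closedBall_zero_iff, le_div_iff₀ hε]
    have hs : ‖F q‖ ≤ √(1 + ‖F q‖ ^ 2) := Real.le_sqrt_of_sq_le (by linarith)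
    have := mul_le_mul_of_nonneg_left hs hε.le
    have e1 : (a₁ q - R) ^ 2 ≤ R ^ 2 := by nlinarith [h₁ q]
    have e2 : (a₂ q - R) ^ 2 ≤ R ^ 2 := by nlinarith [h₂ q]
    have h4 : R ^ 2 < (a₁ q - R) ^ 2 + (a₂ q - R) ^ 2 - ε * √(1 + ‖F q‖ ^ 2) := h3
    nlinarith [sq_nonneg R]
  obtain ⟨q, hqK, hmax⟩ := hK.exists_isMaxOn ⟨q₀, hout q₀ hq₁ hq₂ hq⟩ hgc.continuousOn
  have hgq : R ^ 2 < g q := lt_of_lt_of_le hq (hmax (hout q₀ hq₁ hq₂ hq))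
  have hfq : R ^ 2 < (a₁ q - R) ^ 2 + (a₂ q - R) ^ 2 := by
    have : 0 ≤ ε * √(1 + ‖F q‖ ^ 2) := by positivity
    have h4 : R ^ 2 < (a₁ q - R) ^ 2 + (a₂ q - R) ^ 2 - ε * √(1 + ‖F q‖ ^ 2) := hgq
    linarith
  have hlt₁ : a₁ q < R := by
    refine lt_of_le_of_ne hqK.1.1 fun h => ?_
    rw [h] at hfq
    nlinarith [h₂ q, hqK.1.2]
  have hlt₂ : a₂ q < R := by
    refine lt_of_le_of_ne hqK.1.2 fun h => ?_
    rw [h] at hfq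
    nlinarith [h₁ q, hqK.1.1]
  refine ⟨q, ?_⟩
  filter_upwards [(isOpen_lt ha₁ continuous_const).mem_nhds hlt₁,
    (isOpen_lt ha₂ continuous_const).mem_nhds hlt₂,
    (isOpen_lt continuous_const hgc).mem_nhds hgq] with y hy₁ hy₂ hy₃
  exact hmax (hout y (le_of_lt hy₁) (le_of_lt hy₂) hy₃)

section Quadratic

variable {V : Type*} [NormedAddCommGroup V] [InnerProductSpace ℝ V]

/-- The sum of two squares of affine functions, minus a multiple of the squared norm. -/
noncomputable def cornerQuadratic (b₁ b₂ w₁ w₂ : V) (R δ : ℝ) (x : V) : ℝ :=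
  (⟪x - b₁, w₁⟫_ℝ - R) ^ 2 + (⟪x - b₂, w₂⟫_ℝ - R) ^ 2 - δ * ‖x‖ ^ 2

/-- The differential of `cornerQuadratic`. -/
noncomputable def cornerQuadraticDeriv (b₁ b₂ w₁ w₂ : V) (R δ : ℝ) (x : V) : V →L[ℝ] ℝ :=
  (2 * (⟪x - b₁, w₁⟫_ℝ - R)) • innerSL ℝ w₁ + (2 * (⟪x - b₂, w₂⟫_ℝ - R)) • innerSL ℝ w₂
    - (2 * δ) • innerSL ℝ x

/-- The (constant) Hessian of `cornerQuadratic`. -/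
noncomputable def cornerQuadraticHessian (w₁ w₂ : V) (δ : ℝ) : V →L[ℝ] V →L[ℝ] ℝ :=
  let B : V →L[ℝ] V →L[ℝ] ℝ := innerSL ℝ
  (2 • innerSL ℝ w₁).smulRight (innerSL ℝ w₁) + (2 • innerSL ℝ w₂).smulRight (innerSL ℝ w₂)
    - (2 * δ) • B

lemma cornerQuadraticHessian_apply_self (w₁ w₂ : V) (δ : ℝ) (v : V) :
    cornerQuadraticHessian w₁ w₂ δ v v =
      2 * ⟪w₁, v⟫_ℝ ^ 2 + 2 * ⟪w₂, v⟫_ℝ ^ 2 - 2 * δ * ‖v‖ ^ 2 := by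
  have h : cornerQuadraticHessian w₁ w₂ δ v v = (2 • innerSL ℝ w₁) v * innerSL ℝ w₁ v +
      (2 • innerSL ℝ w₂) v * innerSL ℝ w₂ v - 2 * δ * ⟪v, v⟫_ℝ := rfl
  rw [h, real_inner_self_eq_norm_sq]
  simp
  ring

lemma hasFDerivAt_cornerQuadratic (b₁ b₂ w₁ w₂ : V) (R δ : ℝ) (x : V) :
    HasFDerivAt (cornerQuadratic b₁ b₂ w₁ w₂ R δ) (cornerQuadraticDeriv b₁ b₂ w₁ w₂ R δ x) x := by
  have h : ∀ b w : V, HasFDerivAt (fun x => ⟪x - b, w⟫_ℝ - R) (innerSL ℝ w) x := fun b w => by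
    have := ((innerSL ℝ w).hasFDerivAt (x := x)).sub_const (⟪w, b⟫_ℝ + R)
    refine this.congr_of_eventuallyEq (Eventually.of_forall fun y => ?_)
    simp only [innerSL_apply_apply]
    rw [real_inner_comm, inner_sub_right]
    ring
  have hn := (hasStrictFDerivAt_norm_sq x).hasFDerivAt.const_mul δ
  refine ((((h b₁ w₁).pow 2).add ((h b₂ w₂).pow 2)).sub hn).congr_fderiv ?_
  ext v
  simp [cornerQuadraticDeriv]
  ring

lemma hasFDerivAt_cornerQuadraticDeriv (b₁ b₂ w₁ w₂ : V) (R δ : ℝ) (x : V) :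
    HasFDerivAt (cornerQuadraticDeriv b₁ b₂ w₁ w₂ R δ) (cornerQuadraticHessian w₁ w₂ δ) x := by
  have h : ∀ b w : V, HasFDerivAt (fun x => 2 * (⟪x - b, w⟫_ℝ - R)) (2 • innerSL ℝ w) x :=
    fun b w => by
    have := ((2 • innerSL ℝ w).hasFDerivAt (x := x)).sub_const (2 * (⟪w, b⟫_ℝ + R))
    refine this.congr_of_eventuallyEq (Eventually.of_forall fun y => ?_)
    simp only [smul_apply, innerSL_apply_apply]
    rw [real_inner_comm, inner_sub_right]
    simp
    ring
  let B : V →L[ℝ] V →L[ℝ] ℝ := innerSL ℝ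
  exact (((h b₁ w₁).smul_const (innerSL ℝ w₁)).add ((h b₂ w₂).smul_const (innerSL ℝ w₂))).sub
    (B.hasFDerivAt.const_smul (2 * δ))

/-- The tangent line to the concave function `r ↦ √(1 + r)` replaces the penalty
`√(1 + ‖x‖²)` by a multiple of `‖x‖²` at a maximum point. -/
lemma isLocalMax_cornerQuadratic {M : Type*} [TopologicalSpace M] {F : M → V}
    {b₁ b₂ w₁ w₂ : V} {R ε : ℝ} (hε : 0 < ε) {q : M}
    (h : IsLocalMax (fun q => (⟪F q - b₁, w₁⟫_ℝ - R) ^ 2 + (⟪F q - b₂, w₂⟫_ℝ - R) ^ 2 -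
      ε * √(1 + ‖F q‖ ^ 2)) q) :
    IsLocalMax (cornerQuadratic b₁ b₂ w₁ w₂ R (ε / (2 * √(1 + ‖F q‖ ^ 2))) ∘ F) q := by
  filter_upwards [h] with y hy
  simp only [cornerQuadratic, Function.comp_apply]
  set s := √(1 + ‖F q‖ ^ 2) with hs
  set r := √(1 + ‖F y‖ ^ 2) with hr
  have hspos : 0 < s := Real.sqrt_pos.mpr (by positivity)
  have hs2 : ‖F q‖ ^ 2 = s ^ 2 - 1 := by rw [hs, Real.sq_sqrt (by positivity)]; ring
  have hr2 : ‖F y‖ ^ 2 = r ^ 2 - 1 := by rw [hr, Real.sq_sqrt (by positivity)]; ring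
  have key : ε * r - ε * s ≤ ε / (2 * s) * (r ^ 2 - 1) - ε / (2 * s) * (s ^ 2 - 1) := by
    have : ε / (2 * s) * (r ^ 2 - 1) - ε / (2 * s) * (s ^ 2 - 1) - (ε * r - ε * s)
        = ε / (2 * s) * (r - s) ^ 2 := by field_simp; ring
    have h0 : 0 ≤ ε / (2 * s) * (r - s) ^ 2 := by positivity
    linarith
  rw [hs2, hr2]
  linarith

end Quadratic

end BiHalfspace

/-! ### Translating hypersurfaces in a wedge -/

open BiHalfspace in
theorem mainTheorem1 (n : ℕ) (M : Type*) [TopologicalSpace M] [T2Space M]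
    [SecondCountableTopology M] [Nonempty M] [ChartedSpace (EuclideanSpace ℝ (Fin n)) M]
    [IsManifold (𝓡 n) ∞ M] (F : M → EuclideanSpace ℝ (Fin (n + 1)))
    (hF : Manifold.IsImmersion (𝓡 n) (𝓡 (n + 1)) ∞ F) (hproper : IsProperMap F)
    (htrans : BiHalfspace.IsSelfTranslating F) :
    ¬ ∃ H₁ H₂ : Set (EuclideanSpace ℝ (Fin (n + 1))),
      BiHalfspace.AreTransverseVerticalHalfspaces H₁ H₂ ∧ Set.range F ⊆ H₁ ∩ H₂ := by
  rintro ⟨_, _, ⟨w₁, w₂, ⟨hw₁, he₁, b₁, rfl⟩, ⟨hw₂, he₂, b₂, rfl⟩, hne, hne'⟩, hsub⟩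
  have hpos₁ : ∀ q, 0 ≤ ⟪F q - b₁, w₁⟫_ℝ := fun q => (hsub ⟨q, rfl⟩).1
  have hpos₂ : ∀ q, 0 ≤ ⟪F q - b₂, w₂⟫_ℝ := fun q => (hsub ⟨q, rfl⟩).2
  set κ : ℝ := 1 - |⟪w₁, w₂⟫_ℝ| with hκ
  have hκpos : 0 < κ := by
    have h1 : ⟪w₁, w₂⟫_ℝ < 1 := inner_lt_one_iff_real_of_norm_eq_one hw₁ hw₂ |>.mpr hne
    have h2 : ⟪w₁, -w₂⟫_ℝ < 1 :=
      inner_lt_one_iff_real_of_norm_eq_one hw₁ (by rwa [norm_neg]) |>.mpr hne'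
    rw [inner_neg_right] at h2
    have := abs_lt.mpr ⟨by linarith, h1⟩
    linarith
  have hκ1 : κ ≤ 1 := by have := abs_nonneg ⟪w₁, w₂⟫_ℝ; linarith
  obtain ⟨q₀⟩ := ‹Nonempty M›
  set α := ⟪F q₀ - b₁, w₁⟫_ℝ with hα
  set β := ⟪F q₀ - b₂, w₂⟫_ℝ with hβ
  have hα0 : 0 ≤ α := hpos₁ q₀
  have hβ0 : 0 ≤ β := hpos₂ q₀
  -- with this radius the corner function at `q₀` is at least `R² + 1`
  set R := 2 * (α + β) + 1 with hR
  set s₀ := √(1 + ‖F q₀‖ ^ 2) with hs₀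
  have hs₀pos : 0 < s₀ := Real.sqrt_pos.mpr (by positivity)
  set ε := κ / (n + 1 + s₀) with hε
  have hden : (0 : ℝ) < n + 1 + s₀ := by positivity
  have hεpos : 0 < ε := div_pos hκpos hden
  have hεmul : ε * (n + 1) + ε * s₀ = κ := by rw [hε]; field_simp
  have hFc := hproper.continuous
  obtain ⟨q, hq⟩ := exists_isLocalMax_corner hproper
    (a₁ := fun q => ⟪F q - b₁, w₁⟫_ℝ) (a₂ := fun q => ⟪F q - b₂, w₂⟫_ℝ)
    (by fun_prop) (by fun_prop) hpos₁ hpos₂ (R := R) hεpos (q₀ := q₀)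
    (by change α ≤ R; linarith) (by change β ≤ R; linarith)
    (by
      change R ^ 2 < (α - R) ^ 2 + (β - R) ^ 2 - ε * s₀
      have : 0 < ε * (n + 1) := by positivity
      nlinarith [sq_nonneg α, sq_nonneg β])
  set s := √(1 + ‖F q‖ ^ 2) with hs
  have hspos : 0 < s := Real.sqrt_pos.mpr (by positivity)
  have hmax := isLocalMax_cornerQuadratic hεpos hq
  set δ := ε / (2 * √(1 + ‖F q‖ ^ 2)) with hδ
  set φ := chartAt (EuclideanSpace ℝ (Fin n)) q with hφ
  have hqφ : q ∈ φ.source := mem_chart_source _ q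
  have hFq : (F ∘ φ.symm) (φ q) = F q := by simp [φ.left_inv hqφ]
  have hmaxG : IsLocalMax (cornerQuadratic b₁ b₂ w₁ w₂ R δ ∘ (F ∘ φ.symm)) (φ q) := by
    have : IsLocalMax (cornerQuadratic b₁ b₂ w₁ w₂ R δ ∘ F) (φ.symm (φ q)) := by
      rwa [φ.left_inv hqφ]
    exact this.comp_continuous (φ.continuousAt_symm (φ.map_source hqφ))
  obtain ⟨hT, ν, hνT, hν1, hν⟩ := exists_unit_normal (injective_fderiv_comp_chartAt_symm hF q)
  have t := (stdOrthonormalBasis ℝ (tangentPlane (F ∘ φ.symm) (φ q))).reindex (finCongr hT)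
  have hG : ContDiffAt ℝ 2 (F ∘ φ.symm) (φ q) :=
    contDiffAt_infty.mp (contDiffAt_comp_chartAt_symm hF.contMDiff q) 2
  have key := trace_hessian_add_nonpos hG hν (htrans q ν hνT hν1) t
    (hasFDerivAt_cornerQuadratic b₁ b₂ w₁ w₂ R δ)
    (hasFDerivAt_cornerQuadraticDeriv b₁ b₂ w₁ w₂ R δ _) hmaxG
  have htrace : ∑ k, cornerQuadraticHessian w₁ w₂ δ (t k) (t k) =
      2 * (1 - ⟪w₁, ν⟫_ℝ ^ 2) + 2 * (1 - ⟪w₂, ν⟫_ℝ ^ 2) - 2 * δ * n := by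
    have h1 := sum_sq_inner_tangent hνT hν1 hν t w₁
    have h2 := sum_sq_inner_tangent hνT hν1 hν t w₂
    rw [hw₁, one_pow] at h1
    rw [hw₂, one_pow] at h2
    have h3 : ∀ k, cornerQuadraticHessian w₁ w₂ δ (t k) (t k) =
        2 * ⟪w₁, t k⟫_ℝ ^ 2 + 2 * ⟪w₂, t k⟫_ℝ ^ 2 - 2 * δ := by
      intro k
      have hn : ‖(t k : EuclideanSpace ℝ (Fin (n + 1)))‖ = 1 := t.norm_eq_one k
      rw [cornerQuadraticHessian_apply_self, hn]
      ring
    simp only [h3, Finset.sum_sub_distrib, Finset.sum_add_distrib, ← Finset.mul_sum, h1, h2]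
    simp
    ring
  have hdir : cornerQuadraticDeriv b₁ b₂ w₁ w₂ R δ (F q) (eLast n) =
      -(2 * δ * ⟪F q, eLast n⟫_ℝ) := by
    simp [cornerQuadraticDeriv, he₁, he₂]
  rw [hFq, htrace, hdir] at key
  have hang := sq_inner_add_sq_inner_le hw₁ hw₂ hν1
  have hheight : ⟪F q, eLast n⟫_ℝ ≤ s := by
    have h1 := real_inner_le_norm (F q) (eLast n)
    have h2 : ‖eLast n‖ = 1 := by simp [eLast]
    rw [h2, mul_one] at h1
    exact h1.trans (Real.le_sqrt_of_sq_le (by linarith))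
  have hs1 : 1 ≤ s := Real.le_sqrt_of_sq_le (by nlinarith [sq_nonneg ‖F q‖])
  have hδs : 2 * δ * s = ε := by rw [hδ, ← hs]; field_simp
  have hδpos : 0 < δ := div_pos hεpos (by positivity)
  -- the penalty contributes at most `ε (n + 1)`
  have hpen : 2 * δ * n + 2 * δ * ⟪F q, eLast n⟫_ℝ ≤ ε * (n + 1) := by
    have : (n : ℝ) + ⟪F q, eLast n⟫_ℝ ≤ s * (n + 1) := by 
      nlinarith [(Nat.cast_nonneg n : (0 : ℝ) ≤ n)]
    calc 2 * δ * n + 2 * δ * ⟪F q, eLast n⟫_ℝ = 2 * δ * (n + ⟪F q, eLast n⟫_ℝ) := by ring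
      _ ≤ 2 * δ * (s * (n + 1)) := by gcongr
      _ = ε * (n + 1) := by rw [← hδs]; ring
  have : 0 < ε * s₀ := by positivity
  linarith
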